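/- Let $F$ be a finite field. A linear systematic $(n,k,r,t)$ batch code over $F$ is an injective linear map $\mathcal{C}:F^k\to F^n$ such that $x$ is a sub-vector of $y=\mathcal{C}(x)$ for every $x\in F^k$, together with a decoding map $\mathcal{D}:F^n\times[k]^t\to F^t$ such that, for every query $(i_1,\dots,i_t)\in[k]^t$ (repetitions allowed), $\mathcal{D}(\mathcal{C}(x),i_1,\dots,i_t)=(x_{i_1},\dots,x_{i_t})$ for all $x\in F^k$, and there are $t$ pairwise disjoint recovery sets $R_1,\dots,R_t\subseteq[n]$ of size at most $r$ each such that the $\ell$-th output symbol is computed from the coordinates of $y$ in $R_\ell$ only, $1\le\ell\le t$. Let $\mathcal{B}(k,r,t)$ denote the shortest length $n$ of a linear systematic $(n,k,r,t)$ batch code over $F$. Proposition. Let $r=2$ and $t\in\{3,4\}$. For every $k\ge 1$ such codes exist, so that $\mathcal{B}(k,2,t)$ is well defined and attained, and $$k+t-2+\left\lceil\frac{(t-1)(k-1)+1}{t}\right\rceil\le\mathcal{B}(k,2,t).$$ For every $k\ge 3$, moreover, $$\mathcal{B}(k,2,t)\le k+\left\lceil (t-1)\cdot\frac{k}{2}\right\rceil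 .$$ -/

import Mathlib

/-- `encode : Q^k → Q^n` is an `(n, k, r, t)` batch code over the alphabet `Q`: it is injective and
has a decoding map `decode : Q^n × [k]^t → Q^t` that answers every query `(i_1, …, i_t)` (repetitions
allowed) correctly, where for each query there are `t` pairwise disjoint recovery sets of at most `r`
coordinates such that the `l`-th requested symbol is computed from the coordinates in the `l`-th
recovery set only. -/
def IsBatchCode {Q : Type*} {k n : ℕ} (r t : ℕ) (encode : (Fin k → Q) → (Fin n → Q)) : Prop :=
  Function.Injective encode ∧
    ∃ decode : (Fin n → Q) → (Fin t → Fin k) → (Fin t → Q),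
      (∀ (x : Fin k → Q) (i : Fin t → Fin k), decode (encode x) i = fun l => x (i l)) ∧
      ∀ i : Fin t → Fin k, ∃ R : Fin t → Finset (Fin n),
        (∀ l m : Fin t, l ≠ m → Disjoint (R l) (R m)) ∧
        (∀ l : Fin t, (R l).card ≤ r) ∧
        ∀ (l : Fin t) (y y' : Fin n → Q), (∀ j ∈ R l, y j = y' j) → decode y i l = decode y' i l

/-- The encoding is systematic: the information vector `x` is a sub-vector of its encoding. -/
def IsSystematic {Q : Type*} {k n : ℕ} (encode : (Fin k → Q) → (Fin n → Q)) : Prop :=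
  ∃ s : Fin k ↪ Fin n, ∀ (x : Fin k → Q) (i : Fin k), encode x (s i) = x i

/-- There is a linear systematic `(n, k, r, t)` batch code over the field `F`. -/
def ExistsLinearSystematicBatchCode (F : Type*) [Field F] (n k r t : ℕ) : Prop :=
  ∃ encode : (Fin k → F) →ₗ[F] (Fin n → F), IsSystematic encode ∧ IsBatchCode r t encode

/-- The optimal (shortest) length of a linear systematic batch code over `F` with dimension `k`,
recovery sets of size at most `r` and queries of size `t`. -/
noncomputable def optimalBatchLength (F : Type*) [Field F] (k r t : ℕ) : ℕ :=
  sInf {n : ℕ | ExistsLinearSystematicBatchCode F n k r t}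

/-! For a linear code, a symbol is determined by a set of coordinates exactly when it vanishes
whenever they do. This reduces the batch property to `HasRecoverySets`.

Upper bound: append the parities of the edges of a graph in which every vertex has at least `t - 1`
neighbours. A repeated symbol is recovered from a neighbour outside the query and the parity of the
connecting edge. A cycle (`t = 3`) or a cycle with chords (`t = 4`) has the required number of
edges; `k = 3`, `t = 4` needs the simplex code.

Lower bound: view the coordinates as functionals. Adjoin a symbol outside a subspace `V`, then go
through its other `t - 1` recovery pairs: each gives a new coordinate for free, or two for one
dimension. Spending `1 + ρ` dimensions thus gains at least `t + ρ` coordinates. This is at least two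
per dimension, except for a deficit of one when `ρ = t - 1`, and that takes `t` dimensions. Hence
some hyperplane contains at least `2 * (k - 1) - ⌈(k - 1) / t⌉` coordinates
(`exists_subspace_many_coordinates`). At least `t` more lie outside it, since a nonzero vector that
it annihilates must be detected by `t` disjoint recovery sets. -/

open Module

/-! ### Recovery sets of linear codes as a vanishing condition. -/

section Criterion

variable {F : Type*} [Field F] {k n r t : ℕ}

/-- A linear encoding has recovery sets for every query if, for each query, there are disjoint small
coordinate sets whose vanishing forces the requested symbol to vanish. -/
def HasRecoverySets {ι : Type*} (r t : ℕ) (g : (Fin k → F) →ₗ[F] (ι → F)) : Prop :=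
  ∀ i : Fin t → Fin k, ∃ R : Fin t → Finset ι,
    (∀ l m : Fin t, l ≠ m → Disjoint (R l) (R m)) ∧ (∀ l, (R l).card ≤ r) ∧
    ∀ l x, (∀ j ∈ R l, g x j = 0) → x (i l) = 0

theorem IsBatchCode.hasRecoverySets {g : (Fin k → F) →ₗ[F] (Fin n → F)}
    (h : IsBatchCode r t g) : HasRecoverySets r t g := by
  obtain ⟨-, D, hD, hR⟩ := h
  intro i
  obtain ⟨R, h1, h2, h3⟩ := hR i
  refine ⟨R, h1, h2, fun l x hx => ?_⟩
  have := h3 l (g x) (g 0) (fun j hj => by simp [hx j hj])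
  rw [hD, hD] at this
  simpa using this

/-- Decode from any message that matches `y` on the recovery set: two such messages differ by one
whose coordinates vanish there, so they agree in the requested symbol. The value `0` is used only
for a `y` that no message matches there. -/
theorem IsSystematic.isBatchCode {g : (Fin k → F) →ₗ[F] (Fin n → F)} (hs : IsSystematic g)
    (h : HasRecoverySets r t g) : IsBatchCode r t g := by
  classical
  obtain ⟨s, hs⟩ := hs
  refine ⟨fun x y hxy => funext fun i => by rw [← hs x i, hxy, hs y i], ?_⟩
  choose R h1 h2 h3 using h
  refine ⟨fun y i l => if hx : ∃ x, ∀ j ∈ R i l, g x j = y j then hx.choose (i l) else 0, ?_, ?_⟩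
  · intro x i
    funext l
    have hx : ∃ x', ∀ j ∈ R i l, g x' j = g x j := ⟨x, fun _ _ => rfl⟩
    simp only [dif_pos hx]
    have := h3 i l (hx.choose - x) (fun j hj => by
      simp [map_sub, hx.choose_spec j hj])
    simpa [sub_eq_zero] using this
  · intro i
    refine ⟨R i, h1 i, h2 i, fun l y y' hy => ?_⟩
    have h : (fun x => ∀ j ∈ R i l, g x j = y j) = fun x => ∀ j ∈ R i l, g x j = y' j := by
      funext x
      exact propext (forall₂_congr fun j hj => by rw [hy j hj])
    change (if hx : Exists (fun x => ∀ j ∈ R i l, g x j = y j) then hx.choose (i l) else 0) = _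
    rw [h]

theorem HasRecoverySets.existsLinearSystematicBatchCode {ι : Type*} [Fintype ι]
    {g : (Fin k → F) →ₗ[F] (ι → F)} (h : HasRecoverySets r t g) (s : Fin k ↪ ι)
    (hs : ∀ x i, g x (s i) = x i) (hn : Fintype.card ι = n) :
    ExistsLinearSystematicBatchCode F n k r t := by
  let e : ι ≃ Fin n := Fintype.equivFinOfCardEq hn
  let g' : (Fin k → F) →ₗ[F] (Fin n → F) := (LinearMap.funLeft F F e.symm).comp g
  have hg' : ∀ x j, g' x j = g x (e.symm j) := fun _ _ => rfl
  have hsys : IsSystematic g' := ⟨s.trans e.toEmbedding, fun x i => by simp [hg', hs]⟩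
  refine ⟨g', hsys, hsys.isBatchCode fun i => ?_⟩
  obtain ⟨R, h1, h2, h3⟩ := h i
  refine ⟨fun l => (R l).map e.toEmbedding, fun l m hlm => ?_, fun l => ?_, fun l x hx => ?_⟩
  · simpa [Finset.disjoint_map] using h1 l m hlm
  · simpa using h2 l
  · refine h3 l x fun j hj => ?_
    simpa [hg'] using hx (e j) (by simpa using hj)

end Criterion

/-! ### Upper bounds: graph codes and the simplex code. -/

section Constructions

variable (F : Type*) [Field F] {k t : ℕ}

theorem existsLinearSystematicBatchCode_repetition (k : ℕ) (ht : 0 < t) :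
    ExistsLinearSystematicBatchCode F (k * t) k 2 t := by
  let g : (Fin k → F) →ₗ[F] (Fin k × Fin t → F) := LinearMap.funLeft F F Prod.fst
  have hg : ∀ x j, g x j = x j.1 := fun _ _ => rfl
  refine HasRecoverySets.existsLinearSystematicBatchCode (g := g) (fun i => ?_)
    ⟨fun a => (a, ⟨0, ht⟩), fun a b h => by simpa using h⟩ (fun x i => hg x _) (by simp)
  refine ⟨fun l => {(i l, l)}, fun l m hlm => by simp [hlm], by simp, fun l x hx => ?_⟩
  simpa [hg] using hx

/-- The encoding that appends the parity `x (p e) + x (q e)` of every edge `e`. -/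
def graphEncoding {E : Type*} (p q : E → Fin k) : (Fin k → F) →ₗ[F] (Fin k ⊕ E → F) where
  toFun x := Sum.elim x fun e => x (p e) + x (q e)
  map_add' x y := by
    funext j
    rcases j with j | j <;> simp
    ring
  map_smul' c x := by
    funext j
    rcases j with j | j <;> simp
    ring

/-- In a query, the positions that repeat an earlier symbol can be served injectively by
neighbours outside the query, provided that all vertices have degree at least `t - 1`. -/
theorem exists_private_neighbours (N : Fin k → Finset (Fin k)) (hN : ∀ v, v ∉ N v)
    (hcard : ∀ v, t ≤ (N v).card + 1) (i : Fin t → Fin k) (L : Finset (Fin t))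
    (hL : Lᶜ.image i = Finset.univ.image i) (hinj : Set.InjOn i (Lᶜ : Finset (Fin t))) :
    ∃ f : L → Fin k, Function.Injective f ∧ ∀ l : L, f l ∈ N (i l) ∧ ∀ m, f l ≠ i m := by
  classical
  have hA : (Finset.univ.image i).card + L.card = t := by
    rw [← hL, Finset.card_image_of_injOn hinj, Finset.card_compl_add_card, Fintype.card_fin]
  have key := (Finset.all_card_le_biUnion_card_iff_exists_injective
    (fun l : L => N (i l) \ Finset.univ.image i)).1 ?_
  · obtain ⟨f, hf, hf'⟩ := key
    refine ⟨f, hf, fun l => ?_⟩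
    have := hf' l
    simp only [Finset.mem_sdiff, Finset.mem_image, Finset.mem_univ, true_and, not_exists] at this
    exact ⟨this.1, fun m h => this.2 m h.symm⟩
  · intro S
    rcases S.eq_empty_or_nonempty with rfl | ⟨l, hl⟩
    · simp
    have h1 : S.card ≤ L.card := by simpa using S.card_le_univ
    have h2 : L.card ≤ (N (i l) \ Finset.univ.image i).card := by
      -- The queried vertex `i l` is not its own neighbour, so the query removes at most one less
      -- than its number of distinct symbols. A single neighbourhood then still has `L.card`
      -- vertices, which gives Hall's condition for every nonempty `S`.
      have h3 : (N (i l) ∩ Finset.univ.image i).card + 1 ≤ (Finset.univ.image i).card := by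
        rw [Nat.succ_le_iff]
        refine Finset.card_lt_card ⟨Finset.inter_subset_right, fun h => hN (i l) ?_⟩
        exact (Finset.mem_inter.1 (h (Finset.mem_image_of_mem i (Finset.mem_univ _)))).1
      have h4 := Finset.card_sdiff_add_card_inter (N (i l)) (Finset.univ.image i)
      have := hcard (i l)
      omega
    exact h1.trans (h2.trans (Finset.card_le_card
      (Finset.subset_biUnion_of_mem (fun l : L => N (i l) \ Finset.univ.image i) hl)))

/-- First occurrences in the query are read directly; each repetition uses a private neighbour and
the parity of the joining edge. `N` need not be symmetric: it only selects enough neighbours at each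
vertex. -/
theorem existsLinearSystematicBatchCode_graph {E : Type*} [Fintype E] (p q : E → Fin k)
    (N : Fin k → Finset (Fin k)) (hN : ∀ v, v ∉ N v) (hcard : ∀ v, t ≤ (N v).card + 1)
    (hE : ∀ v, ∀ w ∈ N v, ∃ e, (p e = v ∧ q e = w) ∨ (p e = w ∧ q e = v)) :
    ExistsLinearSystematicBatchCode F (k + Fintype.card E) k 2 t := by
  classical
  refine HasRecoverySets.existsLinearSystematicBatchCode (g := graphEncoding F p q) (fun i => ?_)
    ⟨Sum.inl, Sum.inl_injective⟩ (fun x i => by simp [graphEncoding]) (by simp)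
  let L : Finset (Fin t) := Finset.univ.filter fun l => ∃ m < l, i m = i l
  have hL : Lᶜ.image i = Finset.univ.image i := by
    refine (Finset.image_subset_image (Finset.subset_univ _)).antisymm fun a ha => ?_
    obtain ⟨l, -, rfl⟩ := Finset.mem_image.1 ha
    obtain ⟨m, hm, hmin⟩ := WellFounded.has_min (wellFounded_lt (α := Fin t))
      {m | i m = i l} ⟨l, rfl⟩
    refine Finset.mem_image.2 ⟨m, ?_, hm⟩
    simp only [L, Finset.mem_compl, Finset.mem_filter, Finset.mem_univ, true_and, not_exists,
      not_and]
    exact fun m' hm' h => hmin m' (h.trans hm) hm'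
  have hinj : Set.InjOn i (Lᶜ : Finset (Fin t)) := by
    intro l hl m hm h
    simp only [L, Finset.coe_compl, Set.mem_compl_iff, Finset.mem_coe, Finset.mem_filter,
      Finset.mem_univ, true_and, not_exists, not_and] at hl hm
    rcases lt_trichotomy l m with h' | h' | h'
    · exact absurd h (hm l h')
    · exact h'
    · exact absurd h.symm (hl m h')
  obtain ⟨f, hf, hfN⟩ := exists_private_neighbours N hN hcard i L hL hinj
  choose e he using fun l : L => hE (i l) (f l) (hfN l).1
  let R : Fin t → Finset (Fin k ⊕ E) := fun l =>
    if h : l ∈ L then {Sum.inl (f ⟨l, h⟩), Sum.inr (e ⟨l, h⟩)} else {Sum.inl (i l)}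
  -- A shared edge would have endpoints `{i l, f l} = {i m, f m}`, but `f l` is neither a queried
  -- vertex nor `f m`.
  have hedge : ∀ l m : L, l ≠ m → e l ≠ e m := by
    intro l m hlm h
    have h1 := he l
    have h2 := he m
    rw [h] at h1
    have h3 := (hfN l).2 m
    have h4 := (hfN m).2 l
    have h5 : f l ≠ f m := fun h => hlm (hf h)
    grind
  refine ⟨R, fun l m hlm => ?_, fun l => ?_, fun l x hx => ?_⟩
  · by_cases hl : l ∈ L <;> by_cases hm : m ∈ L
    · have hne : (⟨l, hl⟩ : L) ≠ ⟨m, hm⟩ := fun h => hlm (congrArg Subtype.val h)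
      have h1 := hedge _ _ hne
      have h2 : f ⟨l, hl⟩ ≠ f ⟨m, hm⟩ := fun h => hne (hf h)
      simp [R, hl, hm, h1.symm, h2.symm]
    · have h1 := (hfN ⟨l, hl⟩).2 m
      simp [R, hl, hm, h1.symm]
    · have h1 := (hfN ⟨m, hm⟩).2 l
      simp [R, hl, hm, h1.symm]
    · have h1 : i l ≠ i m := fun h => hlm (hinj (by simpa using hl) (by simpa using hm) h)
      simp [R, hl, hm, h1]
  · by_cases hl : l ∈ L
    · simp [R, hl]
    · simp [R, hl]
  · by_cases hl : l ∈ L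
    · simp only [R, hl, dif_pos, Finset.mem_insert, Finset.mem_singleton, forall_eq_or_imp,
        forall_eq, graphEncoding, LinearMap.coe_mk, AddHom.coe_mk, Sum.elim_inl,
        Sum.elim_inr] at hx
      rcases he ⟨l, hl⟩ with ⟨h1, h2⟩ | ⟨h1, h2⟩ <;> simpa [h1, h2, hx.1] using hx.2
    · simpa [R, hl, graphEncoding] using hx

theorem existsLinearSystematicBatchCode_cycle (hk : 3 ≤ k) :
    ExistsLinearSystematicBatchCode F (k + k) k 2 3 := by
  classical
  let sc : Fin k → Fin k := fun v =>
    ⟨if v.1 + 1 < k then v.1 + 1 else 0, by split_ifs <;> omega⟩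
  let pr : Fin k → Fin k := fun v =>
    ⟨if v.1 = 0 then k - 1 else v.1 - 1, by split_ifs <;> omega⟩
  have h := existsLinearSystematicBatchCode_graph (t := 3) F (E := Fin k) (fun e => e) sc
    (fun v => {sc v, pr v}) (fun v => ?_) (fun v => ?_) (fun v w hw => ?_)
  · simpa using h
  · simp only [Finset.mem_insert, Finset.mem_singleton, Fin.ext_iff, sc, pr]
    split_ifs <;> omega
  · rw [Finset.card_pair]
    simp only [ne_eq, Fin.ext_iff, sc, pr]
    split_ifs <;> omega
  · simp only [Finset.mem_insert, Finset.mem_singleton] at hw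
    rcases hw with rfl | rfl
    · exact ⟨v, Or.inl ⟨rfl, rfl⟩⟩
    · refine ⟨pr v, Or.inr ⟨rfl, ?_⟩⟩
      simp only [Fin.ext_iff, sc, pr]
      split_ifs <;> omega

theorem existsLinearSystematicBatchCode_cycle_chords (hk : 4 ≤ k) :
    ExistsLinearSystematicBatchCode F (k + (k + (k + 1) / 2)) k 2 4 := by
  classical
  obtain ⟨h, hh⟩ : ∃ h, h = (k + 1) / 2 := ⟨_, rfl⟩
  rw [← hh]
  let sc : Fin k → Fin k := fun v =>
    ⟨if v.1 + 1 < k then v.1 + 1 else 0, by split_ifs <;> omega⟩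
  let pr : Fin k → Fin k := fun v =>
    ⟨if v.1 = 0 then k - 1 else v.1 - 1, by split_ifs <;> omega⟩
  -- With `h = ⌈k / 2⌉`, the chords join `v` to `v + h`. For odd `k` the vertex `h - 1` has no such
  -- partner and is joined to `0` instead, which costs the extra half edge.
  let op : Fin k → Fin k := fun v =>
    ⟨if v.1 < h then (if v.1 + h < k then v.1 + h else 0) else v.1 - h, by split_ifs <;> omega⟩
  let inc : Fin h → Fin k := fun e => ⟨e.1, by omega⟩
  have key := existsLinearSystematicBatchCode_graph (t := 4) F (E := Fin k ⊕ Fin h)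
    (Sum.elim (fun e => e) inc) (Sum.elim sc (fun e => op (inc e)))
    (fun v => {sc v, pr v, op v}) (fun v => ?_) (fun v => ?_) (fun v w hw => ?_)
  · simpa using key
  · simp only [Finset.mem_insert, Finset.mem_singleton, Fin.ext_iff, sc, pr, op]
    split_ifs <;> omega
  · rw [Finset.card_eq_three.2 ⟨sc v, pr v, op v, ?_, ?_, ?_, rfl⟩]
    all_goals
      simp only [ne_eq, Fin.ext_iff, sc, pr, op]
      split_ifs <;> first | omega | exact not_false
  · simp only [Finset.mem_insert, Finset.mem_singleton] at hw
    rcases hw with rfl | rfl | rfl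
    · exact ⟨Sum.inl v, Or.inl ⟨rfl, rfl⟩⟩
    · refine ⟨Sum.inl (pr v), Or.inr ⟨rfl, ?_⟩⟩
      simp only [Sum.elim_inl, Fin.ext_iff, sc, pr]
      split_ifs <;> omega
    · by_cases hv : v.1 < h
      · exact ⟨Sum.inr ⟨v.1, hv⟩, Or.inl ⟨rfl, rfl⟩⟩
      · refine ⟨Sum.inr ⟨v.1 - h, by omega⟩, Or.inr ⟨?_, ?_⟩⟩
        · simp only [Sum.elim_inr, Fin.ext_iff, inc, op]
          split_ifs <;> omega
        · simp only [Sum.elim_inr, Fin.ext_iff, inc, op]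
          split_ifs <;> omega

/-- The encoding of the binary simplex code of dimension three, over an arbitrary field. -/
def simplexEncoding : (Fin 3 → F) →ₗ[F] (Fin 7 → F) where
  toFun x := ![x 0, x 1, x 2, x 0 + x 1, x 0 + x 2, x 1 + x 2, x 0 + x 1 + x 2]
  map_add' x y := by
    funext j
    fin_cases j <;> simp <;> ring
  map_smul' c x := by
    funext j
    fin_cases j <;> simp <;> ring

/-- The four recovery sets of each symbol in the simplex code of dimension three. -/
def simplexRecovery : Fin 3 → Fin 4 → Finset (Fin 7) :=
  ![![{0}, {1, 3}, {2, 4}, {5, 6}], ![{1}, {0, 3}, {2, 5}, {4, 6}],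
    ![{2}, {0, 4}, {1, 5}, {3, 6}]]

theorem exists_disjoint_simplexRecovery : ∀ a b c d : Fin 3, ∃ p q : Fin 4,
    Disjoint (simplexRecovery a p) (simplexRecovery b q) ∧ ∃ r : Fin 4,
    (Disjoint (simplexRecovery a p) (simplexRecovery c r) ∧
      Disjoint (simplexRecovery b q) (simplexRecovery c r)) ∧ ∃ s : Fin 4,
    Disjoint (simplexRecovery a p) (simplexRecovery d s) ∧
      Disjoint (simplexRecovery b q) (simplexRecovery d s) ∧
      Disjoint (simplexRecovery c r) (simplexRecovery d s) := by
  decide +kernel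

theorem simplexRecovery_spec (a : Fin 3) (p : Fin 4) (x : Fin 3 → F)
    (hx : ∀ j ∈ simplexRecovery a p, simplexEncoding F x j = 0) : x a = 0 := by
  fin_cases a <;> fin_cases p <;> simp [simplexRecovery, simplexEncoding] at hx ⊢ <;> grind

/-- Three vertices cannot each have three distinct neighbours, so the graph construction fails here;
length `7` is within the bound `3 + ⌈9 / 2⌉ = 8`. -/
theorem existsLinearSystematicBatchCode_simplex :
    ExistsLinearSystematicBatchCode F 7 3 2 4 := by
  refine HasRecoverySets.existsLinearSystematicBatchCode (g := simplexEncoding F) (fun i => ?_)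
    (Fin.castLEEmb (by norm_num)) (fun x i => ?_) (by simp)
  · obtain ⟨p, q, h1, r, ⟨h2, h3⟩, s, h4, h5, h6⟩ :=
      exists_disjoint_simplexRecovery (i 0) (i 1) (i 2) (i 3)
    refine ⟨fun l => simplexRecovery (i l) (![p, q, r, s] l), ?_, fun l => ?_,
      fun l x hx => simplexRecovery_spec F _ _ x hx⟩
    · intro l m hlm
      fin_cases l <;> fin_cases m <;>
        first
          | exact absurd rfl hlm
          | assumption
          | exact Disjoint.symm (by assumption)
    · have : ∀ a p, (simplexRecovery a p).card ≤ 2 := by decide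
      exact this _ _
  · fin_cases i <;> rfl

end Constructions

/-! ### Lower bound: subspaces containing many coordinate functionals. -/

section LowerBound

variable {F : Type*} [Field F] {ι W : Type*} [AddCommGroup W] [Module F W]

open Classical in
/-- A recovery pair for `u ∈ V'`, `u ∉ V` either already has an element in `V' \ V`, or consists of
two elements outside `V'` that enter together at the cost of one dimension. -/
theorem recovery_pair_dichotomy {V V' : Submodule F W} (e : ι → W) {u : W} (hu : u ∉ V)
    (hu' : u ∈ V') {P : Finset ι} (hP : P.card ≤ 2) (hspan : u ∈ Submodule.span F (e '' P)) :
    1 ≤ (P.filter fun j => e j ∈ V' ∧ e j ∉ V).card ∨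
      ∃ b, e b ∉ V' ∧ P.card = 2 ∧ ∀ j ∈ P, e j ∈ V' ⊔ F ∙ e b ∧ e j ∉ V' := by
  by_cases hex : ∃ j ∈ P, e j ∈ V' ∧ e j ∉ V
  · left
    obtain ⟨j, hj, hj'⟩ := hex
    exact Finset.card_pos.2 ⟨j, Finset.mem_filter.2 ⟨hj, hj'⟩⟩
  right
  push Not at hex
  have h0 : u ≠ 0 := fun h => hu (h ▸ V.zero_mem)
  rcases Nat.lt_or_ge P.card 2 with hlt | hge
  · exfalso
    rcases (by omega : P.card = 0 ∨ P.card = 1) with h | h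
    · rw [Finset.card_eq_zero] at h
      subst h
      simp at hspan
      exact h0 hspan
    · obtain ⟨b, rfl⟩ := Finset.card_eq_one.1 h
      rw [Finset.coe_singleton, Set.image_singleton, Submodule.mem_span_singleton] at hspan
      obtain ⟨c, rfl⟩ := hspan
      have hc : c ≠ 0 := fun h => h0 (by simp [h])
      exact hu (V.smul_mem c (hex b (by simp) ((V'.smul_mem_iff hc).1 hu')))
  · have h2 : P.card = 2 := le_antisymm hP hge
    obtain ⟨b, c, hbc, rfl⟩ := Finset.card_eq_two.1 h2
    rw [Finset.coe_pair, Set.image_pair, Submodule.mem_span_pair] at hspan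
    obtain ⟨β, γ, rfl⟩ := hspan
    -- Applied twice, with the two elements of the pair exchanged, this puts both outside `V'` and
    -- makes the coefficient of `e c` nonzero.
    have key : ∀ (b c : ι) (β γ : F), (e b ∈ V' → e b ∈ V) → (e c ∈ V' → e c ∈ V) →
        β • e b + γ • e c ∉ V → β • e b + γ • e c ∈ V' → e b ∉ V' ∧ β ≠ 0 := by
      intro b c β γ hb hc hn hm
      have hbV : e b ∉ V' := by
        intro hbV
        have h1 : γ • e c ∈ V' := (V'.add_mem_iff_right (V'.smul_mem β hbV)).1 hm
        have h2 : γ • e c ∉ V := fun h => hn (V.add_mem (V.smul_mem β (hb hbV)) h)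
        have hγ : γ ≠ 0 := fun h => h2 (by simp [h])
        exact h2 (V.smul_mem γ (hc ((V'.smul_mem_iff hγ).1 h1)))
      refine ⟨hbV, ?_⟩
      rintro rfl
      rw [zero_smul, zero_add] at hn hm
      have hγ : γ ≠ 0 := fun h => hn (by simp [h])
      exact hn (V.smul_mem γ (hc ((V'.smul_mem_iff hγ).1 hm)))
    have hb := hex b (by simp)
    have hc := hex c (by simp)
    obtain ⟨hbV, -⟩ := key b c β γ hb hc hu hu'
    obtain ⟨hcV, hγ⟩ := key c b γ β hc hb (by rwa [add_comm]) (by rwa [add_comm])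
    refine ⟨b, hbV, h2, ?_⟩
    have hbm : e b ∈ V' ⊔ F ∙ e b := Submodule.mem_sup_right (Submodule.mem_span_singleton_self _)
    have hcm : e c ∈ V' ⊔ F ∙ e b := by
      have h1 := (Submodule.add_mem_iff_right _ (Submodule.smul_mem _ β hbm)).1
        (Submodule.mem_sup_left (T := F ∙ e b) hu')
      exact (Submodule.smul_mem_iff _ hγ).1 h1
    intro j hj
    rcases Finset.mem_insert.1 hj with rfl | hj
    · exact ⟨hbm, hbV⟩
    · rw [Finset.mem_singleton.1 hj]
      exact ⟨hcm, hcV⟩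

-- Adjoin `u`, then treat the pairs one at a time by `recovery_pair_dichotomy`; `ρ` counts those
-- that cost a dimension. The process stops on reaching dimension `D`. The bound `2 * ρ` survives an
-- early stop, while `I.card + ρ` requires that every pair has been treated.
open Classical in
theorem exists_subspace_of_recovery_pairs [FiniteDimensional F W] {κ : Type*} (e : ι → W)
    {V : Submodule F W} {u : W} (hu : u ∉ V) {D : ℕ} (hD : finrank F V < D) (P : κ → Finset ι)
    (hP : ∀ i, (P i).card ≤ 2) (hspan : ∀ i, u ∈ Submodule.span F (e '' P i)) (I : Finset κ) :
    ∃ (V' : Submodule F W) (ρ : ℕ), V ≤ V' ∧ u ∈ V' ∧ finrank F V' = finrank F V + 1 + ρ ∧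
      finrank F V' ≤ D ∧ 2 * ρ ≤ ∑ i ∈ I, ((P i).filter fun j => e j ∈ V' ∧ e j ∉ V).card ∧
      (finrank F V' = D ∨ (ρ ≤ I.card ∧
        I.card + ρ ≤ ∑ i ∈ I, ((P i).filter fun j => e j ∈ V' ∧ e j ∉ V).card)) := by
  induction I using Finset.induction_on with
  | empty =>
    refine ⟨V ⊔ F ∙ u, 0, le_sup_left,
      Submodule.mem_sup_right (Submodule.mem_span_singleton_self _), ?_, ?_, by simp, by simp⟩
    · rw [Submodule.finrank_sup_span_singleton hu]
    · rw [Submodule.finrank_sup_span_singleton hu]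
      omega
  | insert i I hi ih =>
    obtain ⟨V', ρ, hV, huV, hr, hle, h2, h3⟩ := ih
    by_cases hfull : finrank F V' = D
    · refine ⟨V', ρ, hV, huV, hr, hle, ?_, Or.inl hfull⟩
      rw [Finset.sum_insert hi]
      omega
    obtain ⟨h4, h5⟩ := h3.resolve_left hfull
    rcases recovery_pair_dichotomy e hu huV (hP i) (hspan i) with h | ⟨b, hb, hc, hj⟩
    · refine ⟨V', ρ, hV, huV, hr, hle, ?_, Or.inr ?_⟩
      · rw [Finset.sum_insert hi]
        omega
      · rw [Finset.sum_insert hi, Finset.card_insert_of_notMem hi]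
        omega
    · have hVb : V' ≤ V' ⊔ F ∙ e b := le_sup_left
      have hi2 : ((P i).filter fun j => e j ∈ V' ⊔ F ∙ e b ∧ e j ∉ V) = P i :=
        Finset.filter_true_of_mem fun j hjP => ⟨(hj j hjP).1, fun h => (hj j hjP).2 (hV h)⟩
      have hmono : ∑ i ∈ I, ((P i).filter fun j => e j ∈ V' ∧ e j ∉ V).card ≤
          ∑ i ∈ I, ((P i).filter fun j => e j ∈ V' ⊔ F ∙ e b ∧ e j ∉ V).card :=
        Finset.sum_le_sum fun i _ => Finset.card_le_card
          (Finset.monotone_filter_right _ fun j _ hj => ⟨hVb hj.1, hj.2⟩)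
      have hfr := Submodule.finrank_sup_span_singleton hb
      refine ⟨V' ⊔ F ∙ e b, ρ + 1, hV.trans hVb, hVb huV, by omega, by omega, ?_, Or.inr ?_⟩
      · rw [Finset.sum_insert hi, hi2]
        omega
      · rw [Finset.sum_insert hi, Finset.card_insert_of_notMem hi, hi2]
        omega

open Classical in
/-- If a spanning family of vectors has, for each member, `t` disjoint recovery sets of size at most
two, one of which is a single coordinate, then there is a subspace of each dimension `D` that
contains at least `2 * D - ⌈D / t⌉` of the coordinates. -/
theorem exists_subspace_many_coordinates [FiniteDimensional F W] [Fintype ι] {κ : Type*} {t : ℕ}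
    (e : ι → W) (a : κ → W) (ha : Submodule.span F (Set.range a) = ⊤)
    (hrec : ∀ v, ∃ (P : Fin t → Finset ι) (l₀ : Fin t) (s : ι), P l₀ = {s} ∧ e s = a v ∧
      (∀ l m, l ≠ m → Disjoint (P l) (P m)) ∧ (∀ l, (P l).card ≤ 2) ∧
      ∀ l, a v ∈ Submodule.span F (e '' P l))
    (ht : 0 < t) {D : ℕ} (hDW : D ≤ finrank F W) (V : Submodule F W) (hV : finrank F V ≤ D)
    (hcount : 2 * finrank F V ≤
      (Finset.univ.filter fun j => e j ∈ V).card + finrank F V / t) :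
    ∃ V' : Submodule F W, finrank F V' = D ∧
      2 * D ≤ (Finset.univ.filter fun j => e j ∈ V').card + (D + t - 1) / t := by
  induction hd : D - finrank F V using Nat.strong_induction_on generalizing V with
  | _ d ih =>
  rcases hV.eq_or_lt with hVD | hVD
  · refine ⟨V, hVD, ?_⟩
    rw [hVD] at hcount
    have : D / t ≤ (D + t - 1) / t := Nat.div_le_div_right (by omega)
    omega
  obtain ⟨v, hv⟩ : ∃ v, a v ∉ V := by
    by_contra! h
    have : V = ⊤ := by
      rw [eq_top_iff, ← ha, Submodule.span_le]
      rintro _ ⟨v, rfl⟩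
      exact h v
    rw [this, finrank_top] at hVD
    omega
  obtain ⟨P, l₀, s, hl₀, hs, hdisj, hP, hspan⟩ := hrec v
  obtain ⟨V', ρ, hVV, hvV, hr, hle, h2, h3⟩ :=
    exists_subspace_of_recovery_pairs e hv hVD P hP hspan (Finset.univ.erase l₀)
  have hcardI : (Finset.univ.erase l₀).card = t - 1 := by
    rw [Finset.card_erase_of_mem (Finset.mem_univ _), Finset.card_univ, Fintype.card_fin]
  have hgain : (Finset.univ.filter fun j => e j ∈ V).card + (1 + ∑ l ∈ Finset.univ.erase l₀,
      ((P l).filter fun j => e j ∈ V' ∧ e j ∉ V).card) ≤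
      (Finset.univ.filter fun j => e j ∈ V').card := by
    have h1 : ((P l₀).filter fun j => e j ∈ V' ∧ e j ∉ V).card = 1 := by
      rw [hl₀, Finset.filter_true_of_mem, Finset.card_singleton]
      intro j hj
      rw [Finset.mem_singleton.1 hj, hs]
      exact ⟨hvV, hv⟩
    rw [← h1, Finset.add_sum_erase _ (fun l => ((P l).filter fun j => e j ∈ V' ∧ e j ∉ V).card)
      (Finset.mem_univ l₀), ← Finset.card_biUnion, ← Finset.card_union_of_disjoint]
    · refine Finset.card_le_card fun j hj => ?_
      simp only [Finset.mem_union, Finset.mem_filter, Finset.mem_univ, true_and,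
        Finset.mem_biUnion] at hj ⊢
      rcases hj with hj | ⟨l, -, hj, -⟩
      · exact hVV hj
      · exact hj
    · rw [Finset.disjoint_left]
      intro j hj hj'
      simp only [Finset.mem_filter, Finset.mem_univ, true_and, Finset.mem_biUnion] at hj hj'
      obtain ⟨l, -, -, h⟩ := hj'
      exact h hj
    · intro l _ m _ hlm
      exact Finset.disjoint_filter_filter (hdisj l m hlm)
  rw [hcardI] at h3
  -- If `D` is reached, the gain is at least `1 + 2 * ρ` for `1 + ρ` dimensions, one short of two
  -- per dimension. The change from the floor in the invariant to the ceiling in the conclusion pays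
  -- for it, because `finrank F V < D`.
  rcases h3 with h3 | ⟨h3, h4⟩
  · refine ⟨V', h3, ?_⟩
    have hdiv : finrank F V / t + 1 ≤ (D + t - 1) / t := by
      rw [← Nat.add_div_right _ ht]
      exact Nat.div_le_div_right (by omega)
    omega
  · refine ih (D - finrank F V') (by omega) V' hle ?_ rfl
    -- Only `ρ + 1 = t` loses a coordinate, and then the dimension grows by exactly `t`, so the
    -- floor term grows by one.
    rcases (by omega : ρ + 1 < t ∨ ρ + 1 = t) with h | h
    · have : finrank F V / t ≤ finrank F V' / t := Nat.div_le_div_right (by omega)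
      omega
    · have : finrank F V' / t = finrank F V / t + 1 := by
        rw [← Nat.add_div_right _ ht]
        congr 1
        omega
      omega

/-- The coordinate functionals of a linear encoding into `F ^ ι`. -/
def coordinateFunctional {k : ℕ} (g : (Fin k → F) →ₗ[F] (ι → F)) (j : ι) :
    Dual F (Fin k → F) :=
  (LinearMap.proj j).comp g

/-- The subspace has dimension `k - 1`, the largest for which a nonzero message is still
annihilated; the coordinates inside and outside it are counted separately. -/
theorem HasRecoverySets.le_length {k n t : ℕ} {g : (Fin k → F) →ₗ[F] (Fin n → F)}
    (hg : HasRecoverySets 2 t g) (hs : IsSystematic g) (ht : 0 < t) (hk : 1 ≤ k) :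
    t + 2 * (k - 1) ≤ n + (k - 1 + t - 1) / t := by
  classical
  obtain ⟨s, hs⟩ := hs
  let e := coordinateFunctional g
  have he : ∀ j x, e j x = g x j := fun _ _ => rfl
  let a : Fin k → Dual F (Fin k → F) := (Pi.basisFun F (Fin k)).coord
  have hax : ∀ v x, a v x = x v := fun v x => by simp [a]
  have ha : Submodule.span F (Set.range a) = ⊤ := by
    have := (Pi.basisFun F (Fin k)).dualBasis.span_eq
    rwa [Basis.coe_dualBasis] at this
  have hfr : finrank F (Dual F (Fin k → F)) = k := by simp [Subspace.dual_finrank_eq]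
  have hrec : ∀ v, ∃ (P : Fin t → Finset (Fin n)) (l₀ : Fin t) (s : Fin n), P l₀ = {s} ∧
      e s = a v ∧ (∀ l m, l ≠ m → Disjoint (P l) (P m)) ∧ (∀ l, (P l).card ≤ 2) ∧
      ∀ l, a v ∈ Submodule.span F (e '' P l) := by
    intro v
    obtain ⟨R, h1, h2, h3⟩ := hg fun _ => v
    -- By disjointness at most one recovery set contains the systematic coordinate `s v`. Replacing
    -- that set, or an arbitrary one if there is none, by `{s v}` keeps the family disjoint.
    obtain ⟨l₀, hl₀⟩ : ∃ l₀, ∀ l ≠ l₀, s v ∉ R l := by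
      by_cases h : ∃ l, s v ∈ R l
      · obtain ⟨l₀, hl₀⟩ := h
        exact ⟨l₀, fun l hl hl' => Finset.disjoint_left.1 (h1 l l₀ hl) hl' hl₀⟩
      · push Not at h
        exact ⟨⟨0, ht⟩, fun l _ => h l⟩
    have hes : e (s v) = a v := LinearMap.ext fun x => by rw [he, hs, hax]
    refine ⟨Function.update R l₀ {s v}, l₀, s v, by simp, hes, ?_, ?_, ?_⟩
    · intro l m hlm
      by_cases hl : l = l₀
      · subst hl
        simpa [Function.update_of_ne hlm.symm] using hl₀ m hlm.symm
      · by_cases hm : m = l₀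
        · subst hm
          simpa [Function.update_of_ne hlm] using hl₀ l hlm
        · simpa [Function.update_of_ne hl, Function.update_of_ne hm] using h1 l m hlm
    · intro l
      by_cases hl : l = l₀
      · subst hl
        simp
      · simpa [Function.update_of_ne hl] using h2 l
    · intro l
      by_cases hl : l = l₀
      · subst hl
        simp [hes, Submodule.mem_span_singleton_self]
      · rw [Function.update_of_ne hl, Set.image_eq_range]
        refine mem_span_of_iInf_ker_le_ker fun x hx => ?_
        rw [LinearMap.mem_ker, hax]
        refine h3 l x fun j hj => ?_
        rw [Submodule.mem_iInf] at hx
        simpa [he] using hx ⟨j, hj⟩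
  obtain ⟨V, hV, hcount⟩ := exists_subspace_many_coordinates e a ha hrec ht
    (D := k - 1) (by omega) ⊥ (by simp) (by simp)
  obtain ⟨x, hx0, hx⟩ : ∃ x : Fin k → F, x ≠ 0 ∧ ∀ φ ∈ V, φ x = 0 := by
    have h := Subspace.finrank_dualCoannihilator_eq (Φ := V)
    have h' := Subspace.finrank_add_finrank_dualCoannihilator_eq V
    have hfk : finrank F (Fin k → F) = k := by simp
    have hpos : 0 < finrank F V.dualCoannihilator := by omega
    obtain ⟨⟨x, hxm⟩, hx⟩ := (Module.finrank_pos_iff_exists_ne_zero (R := F)).1 hpos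
    refine ⟨x, fun h => hx (Subtype.ext h), fun φ hφ => ?_⟩
    exact (Submodule.mem_dualCoannihilator x).1 hxm φ hφ
  obtain ⟨v, hv⟩ : ∃ v, x v ≠ 0 := Function.ne_iff.1 hx0
  obtain ⟨R, h1, -, h3⟩ := hg fun _ => v
  have hne : ∀ l, ∃ j ∈ R l, g x j ≠ 0 := by
    intro l
    by_contra! h
    exact hv (h3 l x h)
  choose j hjR hj using hne
  have hinj : Function.Injective j := by
    intro l m hlm
    by_contra hne
    exact Finset.disjoint_left.1 (h1 l m hne) (hjR l) (hlm ▸ hjR m)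
  have hcard : t ≤ (Finset.univ.filter fun j => e j ∉ V).card := by
    have : (Finset.univ.image j).card = t := by
      rw [Finset.card_image_of_injective _ hinj, Finset.card_univ, Fintype.card_fin]
    rw [← this]
    refine Finset.card_le_card fun j' hj' => ?_
    obtain ⟨l, -, rfl⟩ := Finset.mem_image.1 hj'
    exact Finset.mem_filter.2 ⟨Finset.mem_univ _, fun h => hj l (hx _ h)⟩
  have htot := Finset.card_filter_add_card_filter_not (s := (Finset.univ : Finset (Fin n)))
    (fun j => e j ∈ V)
  rw [Finset.card_univ, Fintype.card_fin] at htot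
  omega

end LowerBound

theorem mainTheorem4 (F : Type*) [Field F] [Finite F] (k t : ℕ) (hk : 1 ≤ k)
    (ht : t = 3 ∨ t = 4) :
    ExistsLinearSystematicBatchCode F (optimalBatchLength F k 2 t) k 2 t ∧
    (k : ℤ) + (t : ℤ) - 2 + ⌈(((t : ℚ) - 1) * ((k : ℚ) - 1) + 1) / (t : ℚ)⌉
      ≤ (optimalBatchLength F k 2 t : ℤ) ∧
    (3 ≤ k →
      (optimalBatchLength F k 2 t : ℤ) ≤ (k : ℤ) + ⌈((t : ℚ) - 1) * ((k : ℚ) / 2)⌉) := by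

  have ht0 : 0 < t := by omega
  -- Repetition codes make the set of lengths nonempty, so `sInf` is attained rather than the
  -- default `0`.
  have hmem : ExistsLinearSystematicBatchCode F (optimalBatchLength F k 2 t) k 2 t :=
    Nat.sInf_mem (s := {n | ExistsLinearSystematicBatchCode F n k 2 t})
      ⟨k * t, existsLinearSystematicBatchCode_repetition F k ht0⟩
  refine ⟨hmem, ?_, fun hk3 => ?_⟩
  · obtain ⟨g, hs, hg⟩ := hmem
    have h := hg.hasRecoverySets.le_length hs ht0 hk
    generalize optimalBatchLength F k 2 t = n at h
    obtain ⟨D, rfl⟩ : ∃ D, k = D + 1 := ⟨k - 1, by omega⟩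
    rw [Nat.add_sub_cancel] at h
    -- Multiplying by `t` replaces `⌈D / t⌉` by at most `D + t - 1`; the resulting slack `t - 1` is
    -- what leaves the `+ 1` in the numerator of the claimed bound.
    have hdiv : t * ((D + t - 1) / t) ≤ D + t - 1 := Nat.mul_div_le _ _
    have hmul := Nat.mul_le_mul_left t h
    have hceil : ⌈(((t : ℚ) - 1) * (((D + 1 : ℕ) : ℚ) - 1) + 1) / (t : ℚ)⌉ ≤
        (n : ℤ) - (D + 1 : ℕ) - t + 2 := by
      rw [Int.ceil_le, div_le_iff₀ (by exact_mod_cast ht0)]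
      have hmul' : t * (t + 2 * D) + 1 ≤ t * n + (D + t) := by
        rw [mul_add t n] at hmul
        omega
      have : (t : ℚ) * (t + 2 * D) + 1 ≤ t * n + (D + t) := by exact_mod_cast hmul'
      push_cast
      linarith
    linarith
  · rcases ht with rfl | rfl
    · have h : optimalBatchLength F k 2 3 ≤ k + k :=
        Nat.sInf_le (existsLinearSystematicBatchCode_cycle F hk3)
      have hceil : (k : ℤ) ≤ ⌈(((3 : ℕ) : ℚ) - 1) * ((k : ℚ) / 2)⌉ := by
        have : (((3 : ℕ) : ℚ) - 1) * ((k : ℚ) / 2) = ((k : ℤ) : ℚ) := by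
          push_cast
          ring
        rw [this, Int.ceil_intCast]
      omega
    · have h : optimalBatchLength F k 2 4 ≤ k + (k + (k + 1) / 2) := by
        rcases hk3.eq_or_lt with rfl | hk4
        · exact (Nat.sInf_le (existsLinearSystematicBatchCode_simplex F)).trans (by norm_num)
        · exact Nat.sInf_le (existsLinearSystematicBatchCode_cycle_chords F hk4)
      have hceil := Int.le_ceil ((((4 : ℕ) : ℚ) - 1) * ((k : ℚ) / 2))
      generalize ⌈(((4 : ℕ) : ℚ) - 1) * ((k : ℚ) / 2)⌉ = c at hceil
      have : (3 * k : ℤ) ≤ 2 * c := by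
        have : (3 * k : ℚ) ≤ 2 * c := by
          push_cast at hceil
          linarith
        exact_mod_cast this
      omega
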